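/- **Conventions.** $I=[0,1]$; "map" means continuous map; $X^I$ is the space of paths in $X$ with the compact-open topology; $\pi\colon X^I\to X\times X$ is $\pi(\alpha)=(\alpha(0),\alpha(1))$; $\Delta\colon X\to X\times X$ is the diagonal; $s_0\colon X\to X^I$ sends $x$ to the constant path at $x$, so $\pi s_0=\Delta$. *Relative category.* For maps $\alpha\colon A\to B$ and $\beta\colon C\to B$, the join $A*_B C\to B$ is the map induced on the homotopy pushout of the homotopy pullback of $\alpha$ and $\beta$. For a map $f\colon Y\to B$ put $j^0_f=f$, $*^0_BY=Y$, $\iota_0=\mathrm{id}_Y$, and inductively let $j^n_f\colon *^n_BY\to B$ be the join of $j^{n-1}_f$ and $f$, and let $\iota_n\colon Y\to *^n_BY$ be $\iota_{n-1}$ followed by the inclusion $*^{n-1}_BY\to *^n_BY$. Then $\operatorname{relcat}(f)$ is the least integer $n\ge 0$ (or $\infty$ if there is none) for which there is a map $\sigma\colon B\to *^n_BY$ with $j^n_f\sigma\simeq \mathrm{id}_B$ and $\sigma f\simeq\iota_n$. *Monoidal topological complexity.* For $\pi$ the joins are formed strictly: given $\alpha\colon A\to B$ and $\beta\colon C\to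 B$, one takes $$A*_BC=\bigl(A\amalg (A\times_B C\times I)\amalg C\bigr)/\bigl((a,c,0)\sim a,\ (a,c,1)\sim c\bigr)$$ with the map $\langle a,c,t\rangle\mapsto\alpha(a)=\beta(c)$ to $B$. Iterating as above, starting with $\pi$, gives $j^n_\pi\colon *^n_{X\times X}X^I\to X\times X$ and inclusions $\iota_n\colon X^I\to *^n_{X\times X}X^I$ with $j^n_\pi\iota_n=\pi$; put $s_n=\iota_ns_0$. Then $\mathrm{TC}^M(X)$ is the least integer $n\ge 0$ (or $\infty$ if there is none) for which there is a map $\sigma\colon X\times X\to *^n_{X\times X}X^I$ with $j^n_\pi\sigma=\mathrm{id}_{X\times X}$ and $\sigma\Delta=s_n$ (strict equalities). A topological space $X$ is *locally equiconnected* if $\Delta\colon X\to X\times X$ is a closed cofibration, i.e. a closed map with the homotopy extension property with respect to all spaces. **Theorem.** If $X$ is a locally equiconnected space, then $$\mathrm{TC}^M(X)=\operatorname{relcat}(\Delta).$$ -/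

import Mathlib

namespace RelativeCategory

open scoped unitInterval

universe u

section DoubleMappingCylinder

variable {P A B C : Type u} [TopologicalSpace P] [TopologicalSpace A] [TopologicalSpace B]
  [TopologicalSpace C]

/-- The gluing relation on `A ⊔ (P × [0,1]) ⊔ B`: `(p, 0) ∼ u p` and `(p, 1) ∼ v p`. -/
inductive CylinderRel (u : C(P, A)) (v : C(P, B)) : A ⊕ (P × I) ⊕ B → A ⊕ (P × I) ⊕ B → Prop
  | left (p : P) : CylinderRel u v (Sum.inr (Sum.inl (p, 0))) (Sum.inl (u p))
  | right (p : P) : CylinderRel u v (Sum.inr (Sum.inl (p, 1))) (Sum.inr (Sum.inr (v p)))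

/-- The double mapping cylinder of `A ← P → B` (the standard homotopy pushout), with the
quotient topology of `A ⊔ (P × [0,1]) ⊔ B`. -/
abbrev DoubleMappingCylinder (u : C(P, A)) (v : C(P, B)) : Type u :=
  Quot (CylinderRel u v)

/-- The inclusion of the left end `A` in the double mapping cylinder. -/
def DoubleMappingCylinder.inl (u : C(P, A)) (v : C(P, B)) : C(A, DoubleMappingCylinder u v) where
  toFun a := Quot.mk _ (Sum.inl a)
  continuous_toFun := continuous_quot_mk.comp continuous_inl

/-- The map out of a double mapping cylinder given by compatible maps on `A`, `P × [0,1]`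
and `B`. -/
def DoubleMappingCylinder.desc (u : C(P, A)) (v : C(P, B)) (f : C(A, C)) (h : C(P × I, C))
    (g : C(B, C)) (h0 : ∀ p, h (p, 0) = f (u p)) (h1 : ∀ p, h (p, 1) = g (v p)) :
    C(DoubleMappingCylinder u v, C) where
  toFun := Quot.lift (Sum.elim f (Sum.elim h g)) (by
    rintro _ _ (p | p)
    · exact h0 p
    · exact h1 p)
  continuous_toFun :=
    continuous_quot_lift _ (f.continuous.sumElim (h.continuous.sumElim g.continuous))

end DoubleMappingCylinder

/-- A topological space together with a continuous map to `X`. -/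
structure SpaceOver (X : Type u) [TopologicalSpace X] where
  /-- the total space -/
  carrier : Type u
  /-- its topology -/
  [top : TopologicalSpace carrier]
  /-- the map to `X` -/
  proj : C(carrier, X)

attribute [instance] SpaceOver.top

variable {X : Type u} [TopologicalSpace X]

namespace SpaceOver

/-- The standard homotopy pullback of `α : A → X` and `β : B → X`: triples `(a, γ, b)` where `γ`
is a path in `X` from `α a` to `β b`. -/
abbrev HPullback (A B : SpaceOver X) : Type u :=
  {q : A.carrier × C(I, X) × B.carrier // q.2.1 0 = A.proj q.1 ∧ q.2.1 1 = B.proj q.2.2}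

/-- The projection of the homotopy pullback to `A`. -/
def hfst (A B : SpaceOver X) : C(HPullback A B, A.carrier) where
  toFun q := q.1.1
  continuous_toFun := by fun_prop

/-- The projection of the homotopy pullback to `B`. -/
def hsnd (A B : SpaceOver X) : C(HPullback A B, B.carrier) where
  toFun q := q.1.2.2
  continuous_toFun := by fun_prop

/-- The map `(a, γ, b, t) ↦ γ t`. -/
def heval (A B : SpaceOver X) : C(HPullback A B × I, X) where
  toFun q := q.1.1.2.1 q.2
  continuous_toFun := by fun_prop

/-- The join `A *_X B → X` of two arbitrary maps `α : A → X` and `β : B → X`: the homotopy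
pushout of their homotopy pullback, with the map `a ↦ α a`, `(a, γ, b, t) ↦ γ t`,
`b ↦ β b` to `X`. -/
def join (A B : SpaceOver X) : SpaceOver X where
  carrier := DoubleMappingCylinder (hfst A B) (hsnd A B)
  proj := DoubleMappingCylinder.desc _ _ A.proj (heval A B) B.proj
    (fun q => q.2.1) (fun q => q.2.2)

/-- The inclusion `A → A *_X B`. -/
def joinInl (A B : SpaceOver X) : C(A.carrier, (join A B).carrier) :=
  DoubleMappingCylinder.inl _ _

/-- The iterated join `j^n_f : *^n_X Y → X` of `n + 1` copies of `f : Y → X`. -/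
def iterJoin (Y : SpaceOver X) : ℕ → SpaceOver X
  | 0 => Y
  | n + 1 => join (iterJoin Y n) Y

/-- The map `ι_n : Y → *^n_X Y`; `ι_0` is the identity. -/
def iterIncl (Y : SpaceOver X) : (n : ℕ) → C(Y.carrier, (iterJoin Y n).carrier)
  | 0 => ContinuousMap.id _
  | n + 1 => (joinInl (iterJoin Y n) Y).comp (iterIncl Y n)

/-- The strict fibre product `A ×_X B`. -/
abbrev FibreProduct (A B : SpaceOver X) : Type u :=
  {q : A.carrier × B.carrier // A.proj q.1 = B.proj q.2}

/-- The projection of the fibre product to `A`. -/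
def fst (A B : SpaceOver X) : C(FibreProduct A B, A.carrier) where
  toFun q := q.1.1
  continuous_toFun := by fun_prop

/-- The projection of the fibre product to `B`. -/
def snd (A B : SpaceOver X) : C(FibreProduct A B, B.carrier) where
  toFun q := q.1.2
  continuous_toFun := by fun_prop

/-- The explicit (fibrewise) join used for fibrations `α : A → X`, `β : B → X`:
`A ⊔ (A ×_X B × [0,1]) ⊔ B` modulo `(a, b, 0) ∼ a` and `(a, b, 1) ∼ b`, with the map
`⟨a, b, t⟩ ↦ α a = β b` to `X`. -/
def fibJoin (A B : SpaceOver X) : SpaceOver X where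
  carrier := DoubleMappingCylinder (fst A B) (snd A B)
  proj := DoubleMappingCylinder.desc _ _ A.proj
    ((A.proj.comp (fst A B)).comp ContinuousMap.fst) B.proj
    (fun _ => rfl) (fun q => q.2)

/-- The inclusion of `A` in the fibrewise join of `A` and `B`. -/
def fibJoinInl (A B : SpaceOver X) : C(A.carrier, (fibJoin A B).carrier) :=
  DoubleMappingCylinder.inl _ _

/-- The iterated fibrewise join of `n + 1` copies of `p : E → X`. -/
def iterFibJoin (E : SpaceOver X) : ℕ → SpaceOver X
  | 0 => E
  | n + 1 => fibJoin (iterFibJoin E n) E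

/-- The map from `E` to its `n`-th iterated fibrewise join, strictly over `X`. -/
def iterFibIncl (E : SpaceOver X) : (n : ℕ) → C(E.carrier, (iterFibJoin E n).carrier)
  | 0 => ContinuousMap.id _
  | n + 1 => (fibJoinInl (iterFibJoin E n) E).comp (iterFibIncl E n)

end SpaceOver

open SpaceOver

/-- `relcat f ≤ n` for a map `f : Y → X`: the iterated join `j^n_f` admits a homotopy section
`s` with `s ∘ f ≃ ι_n`. -/
def HasRelcatSection {Y : Type u} [TopologicalSpace Y] (f : C(Y, X)) (n : ℕ) : Prop :=
  ∃ s : C(X, (iterJoin ⟨Y, f⟩ n).carrier),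
    ((iterJoin ⟨Y, f⟩ n).proj.comp s).Homotopic (ContinuousMap.id X) ∧
      (s.comp f).Homotopic (iterIncl ⟨Y, f⟩ n)

/-- The relative category of a map: the least `n` (or `∞`) such that `j^n_f` admits a homotopy
section `s` with `s ∘ f ≃ ι_n`. -/
noncomputable def relcat {Y : Type u} [TopologicalSpace Y] (f : C(Y, X)) : ℕ∞ :=
  ⨅ (n : ℕ) (_ : HasRelcatSection f n), (n : ℕ∞)

/-- The diagonal map `Δ : X → X × X`. -/
def diagonal (X : Type u) [TopologicalSpace X] : C(X, X × X) where
  toFun x := (x, x)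
  continuous_toFun := by fun_prop

/-- The path fibration `π : X^I → X × X`, `α ↦ (α 0, α 1)`, where `X^I` carries the
compact-open topology. -/
def pathFibration (X : Type u) [TopologicalSpace X] : SpaceOver (X × X) where
  carrier := C(I, X)
  proj :=
    { toFun := fun α => (α 0, α 1)
      continuous_toFun := by fun_prop }

/-- The map `s_0 : X → X^I` sending a point to the constant path. -/
def constPath (X : Type u) [TopologicalSpace X] : C(X, (pathFibration X).carrier) where
  toFun x := ContinuousMap.const I x
  continuous_toFun := ContinuousMap.continuous_const'

/-- `TC^M(X) ≤ n`: the iterated fibrewise join `j^n_π` of the path fibration admits a strict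
section `s` with `s ∘ Δ = s_n`, where `s_n = ι_n ∘ s_0`. -/
def HasMonoidalSection (X : Type u) [TopologicalSpace X] (n : ℕ) : Prop :=
  ∃ s : C(X × X, (iterFibJoin (pathFibration X) n).carrier),
    (iterFibJoin (pathFibration X) n).proj.comp s = ContinuousMap.id (X × X) ∧
      s.comp (diagonal X) = (iterFibIncl (pathFibration X) n).comp (constPath X)

/-- The monoidal topological complexity `TC^M(X)`: the least `n` (or `∞`) such that `j^n_π`
admits a strict section `s` with `s ∘ Δ = s_n`. -/
noncomputable def monoidalTC (X : Type u) [TopologicalSpace X] : ℕ∞ :=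
  ⨅ (n : ℕ) (_ : HasMonoidalSection X n), (n : ℕ∞)

/-- A closed cofibration: a closed continuous map with the homotopy extension property. (It
suffices to test against spaces `Z` in the universe of `A` and `X`, since that universe contains
the mapping cylinder of `i`.) -/
def IsClosedCofibration {A : Type u} [TopologicalSpace A] (i : C(A, X)) : Prop :=
  IsClosedMap i ∧
    ∀ (Z : Type u) [TopologicalSpace Z] (f : C(X, Z)) (H : C(A × I, Z)),
      (∀ a, H (a, 0) = f (i a)) →
        ∃ K : C(X × I, Z), (∀ x, K (x, 0) = f x) ∧ ∀ a t, K (i a, t) = H (a, t)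

/-- A space is locally equiconnected if its diagonal map is a closed cofibration. -/
def LocallyEquiconnected (X : Type u) [TopologicalSpace X] : Prop :=
  IsClosedCofibration (diagonal X)

end RelativeCategory

/-! The two invariants agree level by level: for each `n` both conditions are compared with
`HasLifts`, which consists of nested height functions on `W` and lifts on the open sets they cut
out. A map into a join amounts to a height `t`, a map to one factor on `t < 1` and a map to the
other on `0 < t`. Reparametrising the height by `stretch` makes such partial data continuous for the
quotient topology (`hasLifts_iff`). Since `π` is the path-space replacement of `Δ`, a strict lift to
`X^I` amounts to a lift through `Δ` up to homotopy. By induction, decomposed lifts to path spaces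
correspond to homotopy lifts to the iterated join of `Δ` (`hasLifts_of_homotopy_lift`,
`HasLifts.exists_homotopy_lift`).

What remains is strictness over the diagonal (`LocallyEquiconnected.exists_relative_section`).
Homotopy extension makes the section `s` agree with `ι_n` there, but the homotopy `H` from `j^n s`
to the identity may still move each `(x, x)` around a loop. These loops extend to a self-homotopy of
the identity of the whole product, `(y, z) ↦ (H(·, (y, y)).1, H(·, (z, z)).2)`. Running it backwards
after `H`, with a cut-off that vanishes on the diagonal, gives a homotopy stationary there. -/

namespace RelativeCategory

open scoped unitInterval

universe u

/-! ### Gluing maps along a height function. -/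

section Gluing

variable {W T : Type*} [TopologicalSpace W] [TopologicalSpace T]

/-- A function that agrees with a continuous map on an open set is continuous there. -/
theorem continuousAt_of_eqOn_isOpen {G : W → T} {U : Set W} (hU : IsOpen U) {w : W} (hw : w ∈ U)
    (F : C(U, T)) (hF : ∀ x : U, G x = F x) : ContinuousAt G w := by
  have h : ContinuousAt (G ∘ ((↑) : U → W)) ⟨w, hw⟩ := by
    have : G ∘ ((↑) : U → W) = F := funext hF
    rw [this]
    exact F.continuous.continuousAt
  exact (hU.isOpenEmbedding_subtypeVal.continuousAt_iff).1 h

/-- Glue maps defined on `{t < 1}`, `{0 < t < 1}` and `{0 < t}` that agree for `t ≤ 1/3`,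
respectively `2/3 ≤ t`. -/
theorem exists_glue (t : C(W, I)) (F₀ : C({w // t w < 1}, T)) (F₁ : C({w // 0 < t w}, T))
    (F : C({w // 0 < t w ∧ t w < 1}, T))
    (h₀ : ∀ w (h : 0 < t w ∧ t w < 1), (t w : ℝ) ≤ 1 / 3 → F ⟨w, h⟩ = F₀ ⟨w, h.2⟩)
    (h₁ : ∀ w (h : 0 < t w ∧ t w < 1), 2 / 3 ≤ (t w : ℝ) → F ⟨w, h⟩ = F₁ ⟨w, h.1⟩) :
    ∃ G : C(W, T), (∀ w (h : t w < 1), (t w : ℝ) ≤ 1 / 3 → G w = F₀ ⟨w, h⟩) ∧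
      (∀ w h, G w = F ⟨w, h⟩) ∧
      ∀ w (h : 0 < t w), 2 / 3 ≤ (t w : ℝ) → G w = F₁ ⟨w, h⟩ := by
  have lt_one {w : W} (h : (t w : ℝ) ≤ 1 / 3) : t w < 1 := by
    rw [← Subtype.coe_lt_coe]; push_cast; linarith
  have pos {w : W} (h : 2 / 3 ≤ (t w : ℝ)) : 0 < t w := by
    rw [← Subtype.coe_lt_coe]; push_cast; linarith
  have mid {w : W} (h : ¬ (t w : ℝ) ≤ 1 / 3) (h' : ¬ 2 / 3 ≤ (t w : ℝ)) :
      0 < t w ∧ t w < 1 := by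
    simp only [← Subtype.coe_lt_coe]; push_cast; constructor <;> linarith
  classical
  let G : W → T := fun w =>
    if h : (t w : ℝ) ≤ 1 / 3 then F₀ ⟨w, lt_one h⟩
    else if h' : 2 / 3 ≤ (t w : ℝ) then F₁ ⟨w, pos h'⟩ else F ⟨w, mid h h'⟩
  have hG₀ : ∀ w (h : t w < 1), (t w : ℝ) ≤ 1 / 3 → G w = F₀ ⟨w, h⟩ := fun w h h' => by
    simp only [G, dif_pos h']
  have hG₁ : ∀ w (h : 0 < t w), 2 / 3 ≤ (t w : ℝ) → G w = F₁ ⟨w, h⟩ := fun w h h' => by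
    have : ¬ (t w : ℝ) ≤ 1 / 3 := by linarith
    simp only [G, dif_neg this, dif_pos h']
  have hG : ∀ w h, G w = F ⟨w, h⟩ := fun w h => by
    by_cases h' : (t w : ℝ) ≤ 1 / 3
    · rw [hG₀ w h.2 h', h₀ w h h']
    · by_cases h'' : 2 / 3 ≤ (t w : ℝ)
      · rw [hG₁ w h.1 h'', h₁ w h h'']
      · simp only [G, dif_neg h', dif_neg h'']
  refine ⟨⟨G, continuous_iff_continuousAt.2 fun w => ?_⟩, hG₀, hG, hG₁⟩
  -- The open sets `t < 1/3`, `2/3 < t` and `0 < t < 1` cover `W`, and on each of them `G` is given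
  -- by a single continuous map.
  by_cases h : (t w : ℝ) < 1 / 3
  · exact continuousAt_of_eqOn_isOpen (U := {w | (t w : ℝ) < 1 / 3})
      (isOpen_lt (by fun_prop) continuous_const) h
      (F₀.comp ⟨fun x => ⟨x.1, lt_one x.2.le⟩, by fun_prop⟩) fun x => hG₀ _ _ x.2.le
  · by_cases h' : 2 / 3 < (t w : ℝ)
    · exact continuousAt_of_eqOn_isOpen (U := {w | 2 / 3 < (t w : ℝ)})
        (isOpen_lt continuous_const (by fun_prop)) h'
        (F₁.comp ⟨fun x => ⟨x.1, pos x.2.le⟩, by fun_prop⟩) fun x => hG₁ _ _ x.2.le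
    · refine continuousAt_of_eqOn_isOpen (U := {w | 0 < t w ∧ t w < 1})
        (IsOpen.inter (s := {w | 0 < t w}) (t := {w | t w < 1})
          (isOpen_lt continuous_const t.continuous)
          (isOpen_lt t.continuous continuous_const)) ?_ F fun x => hG _ _
      simp only [Set.mem_ofPred_eq, ← Subtype.coe_lt_coe]
      push_cast
      constructor <;> linarith

/-- The piecewise linear map `[0,1] → [0,1]` which collapses `[0,1/3]` to `0` and `[2/3,1]`
to `1`. -/
noncomputable def stretch : C(I, I) where
  toFun s := Set.projIcc 0 1 zero_le_one (3 * (s : ℝ) - 1)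
  continuous_toFun := by fun_prop

theorem stretch_eq_zero {s : I} (h : (s : ℝ) ≤ 1 / 3) : stretch s = 0 :=
  Set.projIcc_of_le_left zero_le_one (by linarith)

theorem stretch_eq_one {s : I} (h : 2 / 3 ≤ (s : ℝ)) : stretch s = 1 :=
  Set.projIcc_of_right_le zero_le_one (by linarith)

end Gluing

/-! ### Concatenation and reversal of families of paths. -/

section Concatenation

variable {W T : Type*} [TopologicalSpace W] [TopologicalSpace T]

/-- The map `s ↦ s / 2`. -/
noncomputable def firstHalf : C(I, I) where
  toFun s := ⟨s / 2, by have := s.2.1; positivity, by have := s.2.2; linarith⟩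
  continuous_toFun := by fun_prop

/-- The map `s ↦ (1 + s) / 2`. -/
noncomputable def secondHalf : C(I, I) where
  toFun s := ⟨(1 + s) / 2, by have := s.2.1; positivity, by have := s.2.2; linarith⟩
  continuous_toFun := by fun_prop

theorem firstHalf_zero : firstHalf 0 = 0 := by ext; simp [firstHalf]

theorem secondHalf_one : secondHalf 1 = 1 := by ext; simp [secondHalf]

/-- Lets a concatenation be shown constant by checking its two halves. -/
theorem eq_firstHalf_or_secondHalf (s : I) : (∃ r, s = firstHalf r) ∨ ∃ r, s = secondHalf r := by
  by_cases h : (s : ℝ) ≤ 1 / 2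
  · refine .inl ⟨⟨2 * s, by have := s.2.1; positivity, by linarith⟩, ?_⟩
    ext; simp [firstHalf]
  · refine .inr ⟨⟨2 * s - 1, by linarith, by have := s.2.2; linarith⟩, ?_⟩
    ext; simp [secondHalf]

/-- Concatenation of continuous families of paths. -/
theorem exists_concat (K L : C(W, C(I, T))) (h : ∀ w, K w 1 = L w 0) :
    ∃ M : C(W, C(I, T)), (∀ w, M w 0 = K w 0) ∧ (∀ w, M w 1 = L w 1) ∧
      (∀ w s, M w (firstHalf s) = K w s) ∧ ∀ w s, M w (secondHalf s) = L w s := by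
  suffices ∃ M : C(W, C(I, T)), (∀ w s, M w (firstHalf s) = K w s) ∧
      ∀ w s, M w (secondHalf s) = L w s by
    obtain ⟨M, hK, hL⟩ := this
    refine ⟨M, fun w => ?_, fun w => ?_, hK, hL⟩
    · rw [← hK, firstHalf_zero]
    · rw [← hL, secondHalf_one]
  let M : C(W × I, T) :=
    { toFun := fun p => if (p.2 : ℝ) ≤ 1 / 2 then K p.1 (Set.projIcc 0 1 zero_le_one (2 * p.2))
        else L p.1 (Set.projIcc 0 1 zero_le_one (2 * p.2 - 1))
      continuous_toFun := by
        refine Continuous.if_le (by fun_prop) (by fun_prop) (by fun_prop) (by fun_prop) ?_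
        rintro ⟨w, s⟩ hs
        simp only at hs
        rw [hs, Set.projIcc_of_right_le _ (by norm_num), Set.projIcc_of_le_left _ (by norm_num)]
        exact h w }
  refine ⟨M.curry, fun w s => ?_, fun w s => ?_⟩
  · have h2 : ((firstHalf s : I) : ℝ) = s / 2 := rfl
    have h1 : ((firstHalf s : I) : ℝ) ≤ 1 / 2 := by have := s.2.2; rw [h2]; linarith
    simp only [M, ContinuousMap.curry_apply, ContinuousMap.coe_mk, if_pos h1]
    rw [h2, mul_div_cancel₀ _ two_ne_zero, Set.projIcc_val]
  · have h2 : ((secondHalf s : I) : ℝ) = (1 + s) / 2 := rfl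
    by_cases h1 : ((secondHalf s : I) : ℝ) ≤ 1 / 2
    -- The midpoint `1/2` belongs to the first branch of `M`, so there the value comes from the end
    -- of `K`.
    · have hs : s = 0 := by
        ext; have := s.2.1; rw [h2] at h1; push_cast; linarith
      subst hs
      simp only [M, ContinuousMap.curry_apply, ContinuousMap.coe_mk, if_pos h1]
      rw [← h w, h2, Set.projIcc_of_right_le _ (by norm_num)]
      rfl
    · simp only [M, ContinuousMap.curry_apply, ContinuousMap.coe_mk, if_neg h1]
      rw [h2, mul_div_cancel₀ _ two_ne_zero, add_sub_cancel_left, Set.projIcc_val]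

/-- Reversal of a continuous family of paths. -/
def reversal (K : C(W, C(I, T))) : C(W, C(I, T)) :=
  ContinuousMap.curry ⟨fun p => K p.1 (σ p.2), by fun_prop⟩

@[simp] theorem reversal_apply (K : C(W, C(I, T))) (w : W) (s : I) :
    reversal K w s = K w (σ s) := rfl

end Concatenation

/-! ### Maps out of and into double mapping cylinders. -/

namespace DoubleMappingCylinder

variable {P A B : Type u} {T : Type*} [TopologicalSpace P] [TopologicalSpace A]
  [TopologicalSpace B] [TopologicalSpace T] {u : C(P, A)} {v : C(P, B)}

/-- The point of the double mapping cylinder given by a point of `P` and a height. -/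
def mid (u : C(P, A)) (v : C(P, B)) : C(P × I, DoubleMappingCylinder u v) where
  toFun x := Quot.mk _ (Sum.inr (Sum.inl x))
  continuous_toFun := continuous_quot_mk.comp (by fun_prop)

/-- The inclusion of the right end `B` in the double mapping cylinder. -/
def inr (u : C(P, A)) (v : C(P, B)) : C(B, DoubleMappingCylinder u v) where
  toFun x := Quot.mk _ (Sum.inr (Sum.inr x))
  continuous_toFun := continuous_quot_mk.comp (by fun_prop)

theorem mid_zero (p : P) : mid u v (p, 0) = inl u v (u p) := Quot.sound (.left p)

theorem mid_one (p : P) : mid u v (p, 1) = inr u v (v p) := Quot.sound (.right p)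

theorem ind {motive : DoubleMappingCylinder u v → Prop} (hl : ∀ a, motive (inl u v a))
    (hm : ∀ p s, motive (mid u v (p, s))) (hr : ∀ b, motive (inr u v b)) (z) : motive z := by
  rcases z with ⟨a | ⟨p, s⟩ | b⟩
  exacts [hl a, hm p s, hr b]

/-- The height function of the double mapping cylinder. -/
def height (u : C(P, A)) (v : C(P, B)) : C(DoubleMappingCylinder u v, I) where
  toFun := Quot.lift (Sum.elim (fun _ => 0) (Sum.elim Prod.snd fun _ => 1)) (by
    rintro _ _ (p | p) <;> rfl)
  continuous_toFun := continuous_quot_lift _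
    (continuous_const.sumElim (continuous_snd.sumElim continuous_const))

@[simp] theorem height_inl (a : A) : height u v (inl u v a) = 0 := rfl

@[simp] theorem height_mid (x : P × I) : height u v (mid u v x) = x.2 := rfl

@[simp] theorem height_inr (b : B) : height u v (inr u v b) = 1 := rfl

/-- A quotient map restricts to a quotient map over an open set, so continuity on `O` can be tested
on the three open summands upstairs. -/
theorem continuousOn_of_pieces {G : DoubleMappingCylinder u v → T}
    {O : Set (DoubleMappingCylinder u v)} (hO : IsOpen O)
    (hl : ∀ a, inl u v a ∈ O → ContinuousAt (fun a => G (inl u v a)) a)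
    (hm : ∀ x, mid u v x ∈ O → ContinuousAt (fun x => G (mid u v x)) x)
    (hr : ∀ b, inr u v b ∈ O → ContinuousAt (fun b => G (inr u v b)) b) : ContinuousOn G O := by
  rw [isQuotientMap_quot_mk.continuousOn_isOpen_iff hO]
  refine fun x hx => ContinuousAt.continuousWithinAt ?_
  rcases x with a | x | b
  · exact Topology.IsOpenEmbedding.inl.continuousAt_iff.1 (hl a hx)
  · exact (Topology.IsOpenEmbedding.inr.comp .inl).continuousAt_iff.1 (hm x hx)
  · exact (Topology.IsOpenEmbedding.inr.comp .inr).continuousAt_iff.1 (hr b hx)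

/-- Maps out of the complement of the right end. -/
theorem exists_desc_left (f : C(A, T)) (h : C(P × I, T)) (h0 : ∀ p, h (p, 0) = f (u p)) :
    ∃ G : C({z // height u v z < 1}, T), (∀ a hz, G ⟨inl u v a, hz⟩ = f a) ∧
      ∀ x hz, G ⟨mid u v x, hz⟩ = h x := by
  classical
  rcases isEmpty_or_nonempty T with hT | ⟨⟨d⟩⟩
  · have : IsEmpty {z // height u v z < 1} := by
      refine ⟨fun ⟨z, hz⟩ => ?_⟩
      induction z using ind with
      | hl a => exact hT.false (f a)
      | hm p s => exact hT.false (h (p, s))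
      | hr b => simp at hz
    exact ⟨⟨isEmptyElim, by fun_prop⟩, fun a hz => isEmptyElim (f a), fun x hz => isEmptyElim (h x)⟩
  -- The value `d` at height `1` is arbitrary: `G` may jump there, and only its restriction to the
  -- open set of smaller heights is kept.
  let G : DoubleMappingCylinder u v → T :=
    Quot.lift (Sum.elim f (Sum.elim (fun x => if x.2 < 1 then h x else d) fun _ => d)) (by
      rintro _ _ (p | p)
      · simp [h0]
      · simp)
  have hGm (x : P × I) (hx : x.2 < 1) : G (mid u v x) = h x := if_pos hx
  have hO : IsOpen {z | height u v z < 1} :=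
    isOpen_lt (height u v).continuous continuous_const
  have hG : ContinuousOn G {z | height u v z < 1} := by
    refine continuousOn_of_pieces hO (fun a _ => f.continuous.continuousAt) (fun x hx => ?_)
      fun b hb => absurd hb (by simp)
    refine h.continuous.continuousAt.congr ?_
    filter_upwards [(isOpen_lt (continuous_snd (X := P)) continuous_const).mem_nhds hx] with y hy
    exact (hGm y hy).symm
  exact ⟨⟨_, hG.domRestrict⟩, fun _ _ => rfl, fun x hz => hGm x hz⟩

/-- Maps out of the complement of the left end. -/
theorem exists_desc_right (g : C(B, T)) (h : C(P × I, T)) (h1 : ∀ p, h (p, 1) = g (v p)) :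
    ∃ G : C({z // 0 < height u v z}, T), (∀ b hz, G ⟨inr u v b, hz⟩ = g b) ∧
      ∀ x hz, G ⟨mid u v x, hz⟩ = h x := by
  classical
  rcases isEmpty_or_nonempty T with hT | ⟨⟨d⟩⟩
  · have : IsEmpty {z // 0 < height u v z} := by
      refine ⟨fun ⟨z, hz⟩ => ?_⟩
      induction z using ind with
      | hl a => simp at hz
      | hm p s => exact hT.false (h (p, s))
      | hr b => exact hT.false (g b)
    exact ⟨⟨isEmptyElim, by fun_prop⟩, fun a hz => isEmptyElim (g a), fun x hz => isEmptyElim (h x)⟩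
  let G : DoubleMappingCylinder u v → T :=
    Quot.lift (Sum.elim (fun _ => d) (Sum.elim (fun x => if 0 < x.2 then h x else d) g)) (by
      rintro _ _ (p | p)
      · simp
      · simp [h1])
  have hGm (x : P × I) (hx : 0 < x.2) : G (mid u v x) = h x := if_pos hx
  have hO : IsOpen {z | 0 < height u v z} :=
    isOpen_lt continuous_const (height u v).continuous
  have hG : ContinuousOn G {z | 0 < height u v z} := by
    refine continuousOn_of_pieces hO (fun a ha => absurd ha (by simp)) (fun x hx => ?_)
      fun b _ => g.continuous.continuousAt
    refine h.continuous.continuousAt.congr ?_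
    filter_upwards [(isOpen_lt continuous_const (continuous_snd (X := P))).mem_nhds hx] with y hy
    exact (hGm y hy).symm
  exact ⟨⟨_, hG.domRestrict⟩, fun _ _ => rfl, fun x hz => hGm x hz⟩

/-- Maps into a double mapping cylinder from maps to its two ends and to `P`, on the open sets
where a given function is `< 1`, `> 0`, or both. -/
theorem exists_lift {W : Type*} [TopologicalSpace W] (t : C(W, I)) (a : C({w // t w < 1}, A))
    (b : C({w // 0 < t w}, B)) (m : C({w // 0 < t w ∧ t w < 1}, P))
    (ha : ∀ w, u (m w) = a ⟨w.1, w.2.2⟩) (hb : ∀ w, v (m w) = b ⟨w.1, w.2.1⟩) :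
    ∃ g : C(W, DoubleMappingCylinder u v),
      (∀ w (h : t w < 1), (t w : ℝ) ≤ 1 / 3 → g w = inl u v (a ⟨w, h⟩)) ∧
      (∀ w h, g w = mid u v (m ⟨w, h⟩, stretch (t w))) ∧
      ∀ w (h : 0 < t w), 2 / 3 ≤ (t w : ℝ) → g w = inr u v (b ⟨w, h⟩) := by
  -- `m` need not converge as `t` tends to `0` or `1`. Because `stretch` is constant near the ends,
  -- the map already takes values in an end of the cylinder before `m` ceases to be defined.
  refine exists_glue t ((inl u v).comp a) ((inr u v).comp b)
    ⟨fun w => mid u v (m w, stretch (t w)), by fun_prop⟩ (fun w h h' => ?_) fun w h h' => ?_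
  · simp only [ContinuousMap.coe_mk, ContinuousMap.comp_apply]
    rw [stretch_eq_zero h', mid_zero, ha]
  · simp only [ContinuousMap.coe_mk, ContinuousMap.comp_apply]
    rw [stretch_eq_one h', mid_one, hb]

end DoubleMappingCylinder

open SpaceOver DoubleMappingCylinder

/-! ### Decomposed lifts and the fibrewise join. -/

section Lifts

variable {B Y : Type u} [TopologicalSpace B] [TopologicalSpace Y]

/-- Decomposed lifts of `q : W → B` to `n + 1` copies of `E → B`: a continuous function
`t : W → [0,1]`, a lift to `E` on `{0 < t}` and, recursively, a decomposed lift to `n` copies of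
`E` on `{t < 1}`. Over the image of `f : Y → B`, only the innermost copy is used, and there the
lift is given by `e : Y → E`. -/
def HasLifts (E : SpaceOver B) (f : C(Y, B)) (e : C(Y, E.carrier)) :
    ℕ → ∀ (W : Type u) [TopologicalSpace W], C(W, B) → Prop
  | 0, W, _, q => ∃ s : C(W, E.carrier), (∀ w, E.proj (s w) = q w) ∧ ∀ w y, q w = f y → s w = e y
  | n + 1, W, _, q => ∃ t : C(W, I), (∀ w y, q w = f y → t w = 0) ∧
      HasLifts E f e n {w // t w < 1} (q.comp ⟨Subtype.val, continuous_subtype_val⟩) ∧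
        ∃ s : C({w // 0 < t w}, E.carrier), ∀ w, E.proj (s w) = q w

variable (E : SpaceOver B)

/-- The complement of the right end of a fibrewise join retracts to the left end over the base. -/
theorem exists_fibJoin_left (A E : SpaceOver B) :
    ∃ R : C({z // height (fst A E) (snd A E) z < 1}, A.carrier),
      (∀ a hz, R ⟨inl _ _ a, hz⟩ = a) ∧ ∀ z, A.proj (R z) = (fibJoin A E).proj z.1 := by
  obtain ⟨R, hl, hm⟩ := exists_desc_left (u := fst A E) (v := snd A E) (ContinuousMap.id _)
    ((fst A E).comp ContinuousMap.fst) fun _ => rfl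
  refine ⟨R, hl, fun ⟨z, hz⟩ => ?_⟩
  induction z using DoubleMappingCylinder.ind with
  | hl a => rw [hl]; rfl
  | hm p s => rw [hm]; rfl
  | hr b => simp at hz

/-- The complement of the left end of a fibrewise join retracts to the right end over the base. -/
theorem exists_fibJoin_right (A E : SpaceOver B) :
    ∃ R : C({z // 0 < height (fst A E) (snd A E) z}, E.carrier),
      ∀ z, E.proj (R z) = (fibJoin A E).proj z.1 := by
  obtain ⟨R, hr, hm⟩ := exists_desc_right (u := fst A E) (v := snd A E) (ContinuousMap.id _)
    ((snd A E).comp ContinuousMap.fst) fun _ => rfl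
  refine ⟨R, fun ⟨z, hz⟩ => ?_⟩
  induction z using DoubleMappingCylinder.ind with
  | hl a => simp at hz
  | hm p s => rw [hm]; exact p.2.symm
  | hr b => rw [hr]; rfl

/-- Decomposed lifts are the same as lifts to the iterated fibrewise join. -/
theorem hasLifts_iff (f : C(Y, B)) (e : C(Y, E.carrier)) (n : ℕ) :
    ∀ (W : Type u) [TopologicalSpace W] (q : C(W, B)), HasLifts E f e n W q ↔
      ∃ g : C(W, (iterFibJoin E n).carrier), (∀ w, (iterFibJoin E n).proj (g w) = q w) ∧
        ∀ w y, q w = f y → g w = iterFibIncl E n (e y) := by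
  induction n with
  | zero => exact fun W _ q => Iff.rfl
  | succ n ih =>
    intro W _ q
    simp only [HasLifts, ih]
    constructor
    · rintro ⟨t, ht, ⟨a, ha, hae⟩, s, hs⟩
      obtain ⟨g, h₀, h, h₁⟩ := exists_lift (u := fst (iterFibJoin E n) E)
        (v := snd (iterFibJoin E n) E) t a s
        ⟨fun w => ⟨(a ⟨w.1, w.2.2⟩, s ⟨w.1, w.2.1⟩), (ha _).trans (hs ⟨w.1, w.2.1⟩).symm⟩,
          by fun_prop⟩
        (fun _ => rfl) fun _ => rfl
      refine ⟨g, fun w => ?_, fun w y hw => ?_⟩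
      · rcases eq_or_lt_of_le (unitInterval.nonneg' (t := t w)) with h' | h'
        · have h1 : t w < 1 := h' ▸ zero_lt_one
          exact (congrArg (fibJoin _ E).proj (h₀ w h1 (by rw [← h']; norm_num))).trans (ha ⟨w, h1⟩)
        · rcases eq_or_lt_of_le (unitInterval.le_one' (t := t w)) with h'' | h''
          · exact (congrArg (fibJoin _ E).proj (h₁ w h' (by rw [h'']; norm_num))).trans (hs ⟨w, h'⟩)
          · exact (congrArg (fibJoin _ E).proj (h w ⟨h', h''⟩)).trans (ha ⟨w, h''⟩)
      · have h0 : t w = 0 := ht w y hw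
        have h1 : t w < 1 := h0 ▸ zero_lt_one
        exact (h₀ w h1 (by rw [h0]; norm_num)).trans (congrArg (inl _ _) (hae ⟨w, h1⟩ y hw))
    · intro H
      obtain ⟨g, hg, hge⟩ : ∃ g : C(W, DoubleMappingCylinder (fst (iterFibJoin E n) E)
          (snd (iterFibJoin E n) E)), (∀ w, (fibJoin (iterFibJoin E n) E).proj (g w) = q w) ∧
          ∀ w y, q w = f y → g w = inl _ _ (iterFibIncl E n (e y)) := H
      obtain ⟨R, hR, hRp⟩ := exists_fibJoin_left (iterFibJoin E n) E
      obtain ⟨S, hS⟩ := exists_fibJoin_right (iterFibJoin E n) E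
      -- The height of `g` is the decomposing function; the two retractions `R` and `S` turn `g`
      -- into the partial lifts.
      refine ⟨(height _ _).comp g, fun w y hw => ?_,
        ⟨R.comp ⟨fun w => ⟨g w.1, w.2⟩, by fun_prop⟩, fun w => ?_, fun w y hw => ?_⟩,
        S.comp ⟨fun w => ⟨g w.1, w.2⟩, by fun_prop⟩, fun w => ?_⟩
      · rw [ContinuousMap.comp_apply, hge w y hw, height_inl]
      · exact (hRp _).trans (hg _)
      · have := hge w.1 y hw
        simp only [ContinuousMap.comp_apply, ContinuousMap.coe_mk, this]
        exact hR _ _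
      · exact (hS _).trans (hg _)

/-- The universal case: a lift of the identity of `X × X` is a section. -/
theorem hasMonoidalSection_iff (X : Type u) [TopologicalSpace X] (n : ℕ) :
    HasMonoidalSection X n ↔
      HasLifts (pathFibration X) (diagonal X) (constPath X) n (X × X) (ContinuousMap.id _) := by
  rw [hasLifts_iff]
  refine exists_congr fun g => and_congr ?_ ?_
  · exact ContinuousMap.ext_iff
  · rw [ContinuousMap.ext_iff]
    refine ⟨fun h w x hw => ?_, fun h x => h _ x rfl⟩
    rw [show w = diagonal X x from hw]
    exact h x

end Lifts

/-! ### Lifts up to homotopy and the homotopy join. -/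

section HomotopyLifts

variable {B : Type u} [TopologicalSpace B]

/-- The complement of the right end of a join maps to the left end, compatibly with the maps to
the base up to a homotopy which is stationary on the left end. -/
theorem exists_join_left (A E : SpaceOver B) :
    ∃ (R : C({z // height (hfst A E) (hsnd A E) z < 1}, A.carrier))
      (K : C({z // height (hfst A E) (hsnd A E) z < 1}, C(I, B))),
      (∀ z, K z 0 = A.proj (R z)) ∧ (∀ z, K z 1 = (join A E).proj z.1) ∧
      ∀ a hz, R ⟨inl _ _ a, hz⟩ = a ∧ ∀ s, K ⟨inl _ _ a, hz⟩ s = A.proj a := by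
  let f : C(A.carrier, A.carrier × C(I, B)) :=
    (ContinuousMap.id _).prodMk (ContinuousMap.curry ⟨fun x => A.proj x.1, by fun_prop⟩)
  -- At height `s` the path is the initial piece `r ↦ γ (s r)`, from the image of the left factor to
  -- `γ s`.
  let h : C(HPullback A E × I, A.carrier × C(I, B)) :=
    ((hfst A E).comp ContinuousMap.fst).prodMk
      (ContinuousMap.curry ⟨fun x => x.1.1.1.2.1 (x.1.2 * x.2), by fun_prop⟩)
  obtain ⟨R, hl, hm⟩ := exists_desc_left (u := hfst A E) (v := hsnd A E) f h fun q => by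
    refine Prod.ext rfl (ContinuousMap.ext fun s => ?_)
    exact (congrArg q.1.2.1 (zero_mul s)).trans q.2.1
  refine ⟨ContinuousMap.fst.comp R, ContinuousMap.snd.comp R, fun ⟨z, hz⟩ => ?_,
    fun ⟨z, hz⟩ => ?_, fun a hz => ?_⟩
  · simp only [ContinuousMap.comp_apply]
    induction z using DoubleMappingCylinder.ind with
    | hl a => rw [hl]; rfl
    | hm q s => rw [hm]; exact (congrArg q.1.2.1 (mul_zero s)).trans q.2.1
    | hr b => simp at hz
  · simp only [ContinuousMap.comp_apply]
    induction z using DoubleMappingCylinder.ind with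
    | hl a => rw [hl]; rfl
    | hm q s =>
      rw [hm]
      change q.1.2.1 (s * 1) = q.1.2.1 s
      rw [mul_one]
    | hr b => simp at hz
  · simp only [ContinuousMap.comp_apply, hl]
    exact ⟨rfl, fun s => rfl⟩

/-- The complement of the left end of a join maps to the right end, compatibly with the maps to
the base up to homotopy. -/
theorem exists_join_right (A E : SpaceOver B) :
    ∃ (R : C({z // 0 < height (hfst A E) (hsnd A E) z}, E.carrier))
      (K : C({z // 0 < height (hfst A E) (hsnd A E) z}, C(I, B))),
      (∀ z, K z 0 = E.proj (R z)) ∧ ∀ z, K z 1 = (join A E).proj z.1 := by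
  let g : C(E.carrier, E.carrier × C(I, B)) :=
    (ContinuousMap.id _).prodMk (ContinuousMap.curry ⟨fun x => E.proj x.1, by fun_prop⟩)
  -- At height `s` the path is `r ↦ γ (1 - (1 - s) r)`, running back from `γ 1` to `γ s`.
  let h : C(HPullback A E × I, E.carrier × C(I, B)) :=
    ((hsnd A E).comp ContinuousMap.fst).prodMk
      (ContinuousMap.curry ⟨fun x => x.1.1.1.2.1 (σ (σ x.1.2 * x.2)), by fun_prop⟩)
  obtain ⟨R, hr, hm⟩ := exists_desc_right (u := hfst A E) (v := hsnd A E) g h fun q => by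
    refine Prod.ext rfl (ContinuousMap.ext fun s => ?_)
    have : σ (σ 1 * s) = 1 := by simp
    exact (congrArg q.1.2.1 this).trans q.2.2
  refine ⟨ContinuousMap.fst.comp R, ContinuousMap.snd.comp R, fun ⟨z, hz⟩ => ?_,
    fun ⟨z, hz⟩ => ?_⟩
  · simp only [ContinuousMap.comp_apply]
    induction z using DoubleMappingCylinder.ind with
    | hl a => simp at hz
    | hm q s =>
      rw [hm]
      have : σ (σ s * 0) = 1 := by simp
      exact (congrArg q.1.2.1 this).trans q.2.2
    | hr b => rw [hr]; rfl
  · simp only [ContinuousMap.comp_apply]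
    induction z using DoubleMappingCylinder.ind with
    | hl a => simp at hz
    | hm q s =>
      rw [hm]
      change q.1.2.1 (σ (σ s * 1)) = q.1.2.1 s
      rw [mul_one, unitInterval.symm_symm]
    | hr b => rw [hr]; rfl

/-- The affine homotopy from the identity of `[0,1]` to the constant map `1/2`. -/
noncomputable def contractToMidpoint : C(I × I, I) where
  toFun x := ⟨(1 - x.2) * x.1 + x.2 * (1 / 2), by
    have h₁ := x.1.2; have h₂ := x.2.2
    exact (convex_Icc (0 : ℝ) 1) h₁ ⟨by norm_num, by norm_num⟩ (by linarith [h₂.2]) h₂.1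
      (by ring)⟩
  continuous_toFun := by fun_prop

/-- At the two ends the contraction traverses exactly one half of the interval, so on a
concatenation of `K₀` with reversed `K₁` it recovers `K₀` and `K₁`. This makes the gluing in
`exists_join_lift` match. -/
theorem contractToMidpoint_zero_left (s : I) : contractToMidpoint (0, s) = firstHalf s := by
  ext; simp [contractToMidpoint, firstHalf]; ring

theorem contractToMidpoint_one_left (s : I) : contractToMidpoint (1, s) = secondHalf (σ s) := by
  ext; simp [contractToMidpoint, secondHalf]; ring

theorem contractToMidpoint_zero_right (r : I) : contractToMidpoint (r, 0) = r := by
  ext; simp [contractToMidpoint]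

theorem contractToMidpoint_one_right (r : I) : contractToMidpoint (r, 1) = firstHalf 1 := by
  ext; simp [contractToMidpoint, firstHalf]

/-- Lifts up to homotopy to two spaces over `B`, over the members of a cover, combine to a lift up
to homotopy to the join. -/
theorem exists_join_lift (A E : SpaceOver B) {W : Type*} [TopologicalSpace W] (q : C(W, B))
    (t : C(W, I)) (a : C({w // t w < 1}, A.carrier)) (K₀ : C({w // t w < 1}, C(I, B)))
    (ha : ∀ w, K₀ w 0 = A.proj (a w)) (ha' : ∀ w, K₀ w 1 = q w)
    (c : C({w // 0 < t w}, E.carrier)) (K₁ : C({w // 0 < t w}, C(I, B)))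
    (hc : ∀ w, K₁ w 0 = E.proj (c w)) (hc' : ∀ w, K₁ w 1 = q w) :
    ∃ (g : C(W, DoubleMappingCylinder (hfst A E) (hsnd A E))) (K : C(W, C(I, B))),
      (∀ w, K w 0 = (join A E).proj (g w)) ∧ (∀ w, K w 1 = q w) ∧
      ∀ w (h : t w < 1), t w = 0 → g w = inl _ _ (a ⟨w, h⟩) := by
  -- `M w` runs from the image of `a` through `q w`, at time `1/2`, to the image of `c`: the path
  -- required by the homotopy pullback.
  obtain ⟨M, hM0, hM1, hM₀, hM₁⟩ := exists_concat (W := {w // 0 < t w ∧ t w < 1})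
    (K₀.comp ⟨fun w => ⟨w.1, w.2.2⟩, by fun_prop⟩)
    (reversal (K₁.comp ⟨fun w => ⟨w.1, w.2.1⟩, by fun_prop⟩)) fun w => by
      simp [ha', hc']
  simp only [ContinuousMap.comp_apply, ContinuousMap.coe_mk, reversal_apply, unitInterval.symm_one,
    ha, hc] at hM0 hM1 hM₀ hM₁
  obtain ⟨g, g₀, gm, g₁⟩ := exists_lift (u := hfst A E) (v := hsnd A E) t a c
    ⟨fun w => ⟨(a ⟨w.1, w.2.2⟩, M w, c ⟨w.1, w.2.1⟩), hM0 w, hM1 w⟩, by fun_prop⟩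
    (fun _ => rfl) fun _ => rfl
  -- On `0 < t < 1` the lift `g` projects to `M` at time `stretch t`; sliding this time to `1/2`
  -- leads to `q`.
  obtain ⟨K, k₀, km, k₁⟩ := exists_glue t K₀ K₁
    (ContinuousMap.curry ⟨fun x => M x.1 (contractToMidpoint (stretch (t x.1), x.2)), by fun_prop⟩)
    (fun w h h' => ContinuousMap.ext fun s => by
      simp only [ContinuousMap.curry_apply, ContinuousMap.coe_mk]
      rw [stretch_eq_zero h', contractToMidpoint_zero_left, hM₀])
    (fun w h h' => ContinuousMap.ext fun s => by
      simp only [ContinuousMap.curry_apply, ContinuousMap.coe_mk]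
      rw [stretch_eq_one h', contractToMidpoint_one_left, hM₁, unitInterval.symm_symm])
  have cases (w : W) : (t w < 1 ∧ (t w : ℝ) ≤ 1 / 3) ∨ (0 < t w ∧ t w < 1) ∨
      (0 < t w ∧ 2 / 3 ≤ (t w : ℝ)) := by
    rcases eq_or_lt_of_le (unitInterval.nonneg' (t := t w)) with h | h
    · exact .inl (by rw [← h]; norm_num)
    · rcases eq_or_lt_of_le (unitInterval.le_one' (t := t w)) with h' | h'
      · exact .inr (.inr (by rw [h']; norm_num))
      · exact .inr (.inl ⟨h, h'⟩)
  refine ⟨g, K, fun w => ?_, fun w => ?_, fun w h h0 => g₀ w h (by rw [h0]; norm_num)⟩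
  · rcases cases w with ⟨h, h'⟩ | h | ⟨h, h'⟩
    · rw [k₀ w h h', g₀ w h h', ha]; rfl
    · rw [km w h, gm w h]
      simp only [ContinuousMap.curry_apply, ContinuousMap.coe_mk]
      rw [contractToMidpoint_zero_right]
      rfl
    · rw [k₁ w h h', g₁ w h h', hc]; rfl
  · rcases cases w with ⟨h, h'⟩ | h | ⟨h, h'⟩
    · rw [k₀ w h h', ha']
    · rw [km w h]
      simp only [ContinuousMap.curry_apply, ContinuousMap.coe_mk]
      rw [contractToMidpoint_one_right, hM₀, ha']
    · rw [k₁ w h h', hc']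

/-- Makes `ι_n` the strict lift of the diagonal towards which a relcat section is deformed. -/
theorem iterJoin_proj_iterIncl (E : SpaceOver B) (n : ℕ) (y : E.carrier) :
    (iterJoin E n).proj (iterIncl E n y) = E.proj y := by
  induction n with
  | zero => rfl
  | succ n ih => exact ih

end HomotopyLifts

/-! ### The diagonal versus the path fibration. -/

section Diagonal

variable {X : Type u} [TopologicalSpace X]

/-- A lift of `q : W → X × X` to the diagonal up to homotopy gives a strict lift to the path
space. -/
theorem exists_pathFibration_lift {W : Type*} [TopologicalSpace W] (q : C(W, X × X))
    (g : C(W, X)) (K : C(W, C(I, X × X))) (h0 : ∀ w, K w 0 = diagonal X (g w))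
    (h1 : ∀ w, K w 1 = q w) :
    ∃ s : C(W, (pathFibration X).carrier), (∀ w, (pathFibration X).proj (s w) = q w) ∧
      ∀ w x, (∀ r, K w r = diagonal X x) → s w = constPath X x := by
  let K₁ : C(W, C(I, X)) := ContinuousMap.curry ⟨fun p => (K p.1 p.2).1, by fun_prop⟩
  let K₂ : C(W, C(I, X)) := ContinuousMap.curry ⟨fun p => (K p.1 p.2).2, by fun_prop⟩
  have e₁ (w r) : K₁ w r = (K w r).1 := rfl
  have e₂ (w r) : K₂ w r = (K w r).2 := rfl
  -- Go from `(q w).1` back to `g w` along the first coordinate, then on to `(q w).2` along the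
  -- second.
  obtain ⟨s, hs0, hs1, hs₁, hs₂⟩ := exists_concat (reversal K₁) K₂ fun w => by
    rw [reversal_apply, unitInterval.symm_one, e₁, e₂, h0]; rfl
  refine ⟨s, fun w => ?_, fun w x hx => ?_⟩
  · change (s w 0, s w 1) = q w
    rw [hs0, hs1, reversal_apply, unitInterval.symm_zero,
      e₁, e₂, h1]
  · refine ContinuousMap.ext fun r => ?_
    change s w r = x
    rcases eq_firstHalf_or_secondHalf r with ⟨r, rfl⟩ | ⟨r, rfl⟩
    · rw [hs₁, reversal_apply, e₁, hx]; rfl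
    · rw [hs₂, e₂, hx]; rfl

/-- A strict lift of `q : W → X × X` to the path space gives a lift to the diagonal up to
homotopy. -/
theorem exists_diagonal_lift {W : Type*} [TopologicalSpace W] (q : C(W, X × X))
    (s : C(W, (pathFibration X).carrier)) (hs : ∀ w, (pathFibration X).proj (s w) = q w) :
    ∃ (g : C(W, X)) (K : C(W, C(I, X × X))), (∀ w, K w 0 = diagonal X (g w)) ∧
      (∀ w, K w 1 = q w) ∧ ∀ w, g w = (q w).1 := by
  let s' : C(W, C(I, X)) := s
  -- Keep the starting point of the path in the first coordinate and follow the path in the second.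
  refine ⟨⟨fun w => s' w 0, by fun_prop⟩,
    ContinuousMap.curry ⟨fun p => (s' p.1 0, s' p.1 p.2), by fun_prop⟩, fun w => rfl, hs,
    fun w => congrArg Prod.fst (hs w)⟩

/-- A lift up to homotopy to the iterated join of the diagonal that is strict over the diagonal
gives a decomposed lift to the path space. -/
theorem hasLifts_of_homotopy_lift (n : ℕ) :
    ∀ (W : Type u) [TopologicalSpace W] (q : C(W, X × X))
      (g : C(W, (iterJoin ⟨X, diagonal X⟩ n).carrier)) (K : C(W, C(I, X × X))),
      (∀ w, K w 0 = (iterJoin ⟨X, diagonal X⟩ n).proj (g w)) → (∀ w, K w 1 = q w) →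
      (∀ w x, q w = diagonal X x → g w = iterIncl ⟨X, diagonal X⟩ n x ∧
        ∀ s, K w s = diagonal X x) →
      HasLifts (pathFibration X) (diagonal X) (constPath X) n W q := by
  induction n with
  | zero =>
    intro W _ q g K h0 h1 hd
    obtain ⟨s, hs, hs'⟩ := exists_pathFibration_lift q g K h0 h1
    exact ⟨s, hs, fun w x hw => hs' w x (hd w x hw).2⟩
  | succ n ih =>
    intro W _ q g' K h0' h1 hd'
    let A := iterJoin (⟨X, diagonal X⟩ : SpaceOver (X × X)) n
    let E : SpaceOver (X × X) := ⟨X, diagonal X⟩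
    let g : C(W, DoubleMappingCylinder (hfst A E) (hsnd A E)) := g'
    have h0 (w) : K w 0 = (join A E).proj (g w) := h0' w
    have hd (w x) (hw : q w = diagonal X x) :
        g w = inl _ _ (iterIncl E n x) ∧ ∀ s, K w s = diagonal X x := hd' w x hw
    obtain ⟨R, L, hL0, hL1, hL⟩ := exists_join_left A E
    obtain ⟨S, M, hM0, hM1⟩ := exists_join_right A E
    let t : C(W, I) := (height _ _).comp g
    let j₀ : C({w // t w < 1}, {z // height (hfst A E) (hsnd A E) z < 1}) :=
      ⟨fun w => ⟨g w.1, w.2⟩, by fun_prop⟩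
    let j₁ : C({w // 0 < t w}, {z // 0 < height (hfst A E) (hsnd A E) z}) :=
      ⟨fun w => ⟨g w.1, w.2⟩, by fun_prop⟩
    -- First from the image of the retracted point to the image of `g`, then along `K` to `q`.
    obtain ⟨N₀, hN0, hN1, hN₀, hN₀'⟩ := exists_concat (L.comp j₀)
      (K.comp (⟨Subtype.val, continuous_subtype_val⟩ : C({w // t w < 1}, W))) fun w =>
        (hL1 _).trans (h0 _).symm
    obtain ⟨N₁, hN₁, hN₁', -, -⟩ := exists_concat (M.comp j₁)
      (K.comp (⟨Subtype.val, continuous_subtype_val⟩ : C({w // 0 < t w}, W))) fun w =>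
        (hM1 _).trans (h0 _).symm
    obtain ⟨s, hs, -⟩ := exists_pathFibration_lift
      (q.comp (⟨Subtype.val, continuous_subtype_val⟩ : C({w // 0 < t w}, W))) (S.comp j₁) N₁
      (fun w => (hN₁ w).trans (hM0 _)) fun w => (hN₁' w).trans (h1 _)
    refine ⟨t, fun w x hw => ?_, ih _ _ (R.comp j₀) N₀
      (fun w => (hN0 w).trans (hL0 _)) (fun w => (hN1 w).trans (h1 _)) ?_, s, hs⟩
    · simp only [t, ContinuousMap.comp_apply, (hd w x hw).1, height_inl]
    · intro w x hw
      have hx := hd w.1 x hw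
      -- Over the diagonal `g` lies in the left end, where `L` is stationary; as `K` is stationary
      -- too, so is `N₀`.
      have hj (h) : j₀ w = ⟨inl _ _ (iterIncl E n x), h⟩ := Subtype.ext hx.1
      have hlt : height (hfst A E) (hsnd A E) (inl _ _ (iterIncl E n x)) < 1 := by simp
      refine ⟨?_, fun r => ?_⟩
      · rw [ContinuousMap.comp_apply, hj hlt]
        exact (hL _ _).1
      · rcases eq_firstHalf_or_secondHalf r with ⟨r, rfl⟩ | ⟨r, rfl⟩
        · rw [hN₀, ContinuousMap.comp_apply, hj hlt, (hL _ _).2]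
          exact iterJoin_proj_iterIncl E n x
        · rw [hN₀']
          exact hx.2 r

/-- A decomposed lift to the path space gives a lift up to homotopy to the iterated join of the
diagonal. -/
theorem HasLifts.exists_homotopy_lift (n : ℕ) :
    ∀ (W : Type u) [TopologicalSpace W] (q : C(W, X × X)),
      HasLifts (pathFibration X) (diagonal X) (constPath X) n W q →
      ∃ (g : C(W, (iterJoin ⟨X, diagonal X⟩ n).carrier)) (K : C(W, C(I, X × X))),
        (∀ w, K w 0 = (iterJoin ⟨X, diagonal X⟩ n).proj (g w)) ∧ (∀ w, K w 1 = q w) ∧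
        ∀ w x, q w = diagonal X x → g w = iterIncl ⟨X, diagonal X⟩ n x := by
  induction n with
  | zero =>
    rintro W _ q ⟨s, hs, -⟩
    obtain ⟨g, K, h0, h1, hg⟩ := exists_diagonal_lift q s hs
    refine ⟨g, K, h0, h1, fun w x hw => ?_⟩
    exact (hg w).trans (congrArg Prod.fst hw)
  | succ n ih =>
    rintro W _ q ⟨t, ht, ha, s, hs⟩
    obtain ⟨a, K₀, ha0, ha1, had⟩ := ih _ _ ha
    obtain ⟨c, K₁, hc0, hc1, -⟩ := exists_diagonal_lift
      (q.comp (⟨Subtype.val, continuous_subtype_val⟩ : C({w // 0 < t w}, W))) s hs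
    obtain ⟨g, K, h0, h1, hd⟩ := exists_join_lift (iterJoin ⟨X, diagonal X⟩ n) ⟨X, diagonal X⟩
      q t a K₀ ha0 ha1 c K₁ hc0 hc1
    refine ⟨g, K, h0, h1, fun w x hw => ?_⟩
    have h : t w = 0 := ht w x hw
    have h' : t w < 1 := h ▸ zero_lt_one
    exact (hd w h' h).trans (congrArg (inl _ _) (had ⟨w, h'⟩ x hw))

/-! ### Making a homotopy section strict over the diagonal. -/

/-- On a locally equiconnected space, a homotopy section `s` of a map `p : J → X × X` with
`s ∘ Δ ≃ i` for a strict lift `i` of `Δ` can be replaced by one which is strict over the diagonal. -/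
theorem LocallyEquiconnected.exists_relative_section (hX : LocallyEquiconnected X) {J : Type u}
    [TopologicalSpace J] (p : C(J, X × X)) (i : C(X, J)) (hi : ∀ x, p (i x) = diagonal X x)
    (s : C(X × X, J)) (hs : (p.comp s).Homotopic (ContinuousMap.id _))
    (hsd : (s.comp (diagonal X)).Homotopic i) :
    ∃ (g : C(X × X, J)) (K : C(X × X, C(I, X × X))), (∀ b, K b 0 = p (g b)) ∧
      (∀ b, K b 1 = b) ∧ ∀ x, g (diagonal X x) = i x ∧ ∀ r, K (diagonal X x) r = diagonal X x := by
  obtain ⟨G⟩ := hsd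
  -- Extend `sΔ ≃ i` to a homotopy of `s`; its end `s₁` satisfies `s₁ Δ = i`.
  obtain ⟨F₀, hF₀, hF₀'⟩ := hX.2 J s ⟨fun y => G (y.2, y.1), by fun_prop⟩ fun x => by simp
  let s₁ : C(X × X, J) := ⟨fun b => F₀ (b, 1), by fun_prop⟩
  have hs₁ (x) : s₁ (diagonal X x) = i x := by
    change F₀ (diagonal X x, 1) = i x
    rw [hF₀']; simp
  have hs₁' : (p.comp s₁).Homotopic (ContinuousMap.id _) := by
    refine ContinuousMap.Homotopic.trans ?_ hs
    refine ⟨⟨⟨fun y => p (F₀ (y.2, σ y.1)), by fun_prop⟩, fun b => ?_, fun b => ?_⟩⟩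
    · simp [s₁]
    · simp [hF₀]
  obtain ⟨H⟩ := hs₁'
  have hH0 (x) : H (0, diagonal X x) = diagonal X x := by simp [hs₁, hi]
  -- Homotopy extension into `(X × X) × 0 ∪ Δ × I` itself yields a retraction `r` of the cylinder
  -- onto this subspace. Its first component `ρ` deforms the identity rel the diagonal.
  obtain ⟨r, hr0, hrd⟩ := hX.2 {y : (X × X) × I // y.2 = 0 ∨ ∃ x, y.1 = diagonal X x} ⟨fun b => ⟨(b, 0), .inl rfl⟩, by fun_prop⟩
    ⟨fun y => ⟨(diagonal X y.1, y.2), .inr ⟨_, rfl⟩⟩, by fun_prop⟩ fun x => rfl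
  let ρ : C((X × X) × I, X × X) := ⟨fun y => (r y).1.1, by fun_prop⟩
  have hρ0 (b) : ρ (b, 0) = b := by simp [ρ, hr0]
  have hρd (x s) : ρ (diagonal X x, s) = diagonal X x := by simp [ρ, hrd]
  -- The cut-off: `l` vanishes on the diagonal, and wherever `l ≠ 1` the deformation `ρ` has ended
  -- in the diagonal.
  let l : C(X × X, I) := ⟨fun b => σ (r (b, 1)).1.2, by fun_prop⟩
  have hld (x) : l (diagonal X x) = 0 := by simp [l, hrd]
  have hl (b) : l b = 1 ∨ ∃ x, ρ (b, 1) = diagonal X x := by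
    rcases (r (b, 1)).2 with h | h
    · exact .inl (by simp [l, h])
    · exact .inr h
  -- `K₁` follows `H` up to time `l`, `K₂` runs the extended loops back from time `l` to `0`, and
  -- `K₃` undoes `ρ`. On the diagonal `l = 0`, so all three are constant.
  let K₁ : C(X × X, C(I, X × X)) :=
    ContinuousMap.curry ⟨fun y => H (l y.1 * y.2, ρ (y.1, 1)), by fun_prop⟩
  let K₂ : C(X × X, C(I, X × X)) := ContinuousMap.curry
    ⟨fun y => ((H (l y.1 * σ y.2, diagonal X (ρ (y.1, 1)).1)).1,
      (H (l y.1 * σ y.2, diagonal X (ρ (y.1, 1)).2)).2), by fun_prop⟩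
  let K₃ : C(X × X, C(I, X × X)) := ContinuousMap.curry ⟨fun y => ρ (y.1, σ y.2), by fun_prop⟩
  have e₁ (b r) : K₁ b r = H (l b * r, ρ (b, 1)) := rfl
  have e₂ (b r) : K₂ b r = ((H (l b * σ r, diagonal X (ρ (b, 1)).1)).1,
    (H (l b * σ r, diagonal X (ρ (b, 1)).2)).2) := rfl
  have e₃ (b r) : K₃ b r = ρ (b, σ r) := rfl
  -- The junction matches: if `l b = 1`, both sides are `ρ (b, 1)` because `H` ends at the identity;
  -- otherwise `ρ (b, 1)` is diagonal, and there the extended loops coincide with `H`.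
  obtain ⟨M, hM0, hM1, hM₁, hM₂⟩ := exists_concat K₁ K₂ fun b => by
    rw [e₁, e₂, unitInterval.symm_zero, mul_one]
    rcases hl b with h | ⟨x, h⟩
    · simp [h, diagonal]
    · rw [h]; rfl
  obtain ⟨K, hK0, hK1, hK₁, hK₂⟩ := exists_concat M K₃ fun b => by
    rw [hM1, e₂, e₃, unitInterval.symm_one, unitInterval.symm_zero, mul_zero,
      hH0, hH0]
    rfl
  refine ⟨s₁.comp ⟨fun b => ρ (b, 1), by fun_prop⟩, K, fun b => ?_, fun b => ?_,
    fun x => ⟨?_, fun r => ?_⟩⟩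
  · rw [hK0, hM0, e₁]
    simp
  · rw [hK1, e₃, unitInterval.symm_one, hρ0]
  · simp [hρd, hs₁]
  · rcases eq_firstHalf_or_secondHalf r with ⟨r, rfl⟩ | ⟨r, rfl⟩
    · rw [hK₁]
      rcases eq_firstHalf_or_secondHalf r with ⟨r, rfl⟩ | ⟨r, rfl⟩
      · rw [hM₁, e₁, hld, zero_mul, hρd, hH0]
      · rw [hM₂, e₂, hld, zero_mul, hρd, hH0, hH0]
        rfl
    · rw [hK₂, e₃, hρd]

/-- Local equiconnectedness enters in the converse, where a relcat section, given only up to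
homotopy, must become strict over the diagonal before it can be decomposed. -/
theorem hasMonoidalSection_iff_hasRelcatSection (hX : LocallyEquiconnected X) (n : ℕ) :
    HasMonoidalSection X n ↔ HasRelcatSection (diagonal X) n := by
  rw [hasMonoidalSection_iff]
  constructor
  · intro h
    obtain ⟨g, K, h0, h1, hd⟩ := h.exists_homotopy_lift
    refine ⟨g, ⟨⟨⟨fun y => K y.2 y.1, by fun_prop⟩, h0, h1⟩⟩, ?_⟩
    have : g.comp (diagonal X) = iterIncl ⟨X, diagonal X⟩ n :=
      ContinuousMap.ext fun x => hd _ x rfl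
    rw [this]
  · rintro ⟨s, hs, hsd⟩
    obtain ⟨g, K, h0, h1, hd⟩ := hX.exists_relative_section _ _
      (iterJoin_proj_iterIncl ⟨X, diagonal X⟩ n) s hs hsd
    refine hasLifts_of_homotopy_lift n _ _ g K h0 h1 fun w x hw => ?_
    rw [show w = diagonal X x from hw]
    exact hd x

end Diagonal

end RelativeCategory

theorem mainTheorem1 {X : Type*} [TopologicalSpace X]
    (hX : RelativeCategory.LocallyEquiconnected X) :
    RelativeCategory.monoidalTC X =
      RelativeCategory.relcat (RelativeCategory.diagonal X) := by
  simp only [RelativeCategory.monoidalTC, RelativeCategory.relcat,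
    RelativeCategory.hasMonoidalSection_iff_hasRelcatSection hX]
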